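/- Let $\mathbb F$ be an arbitrary field and let $n\ge 0$. A matrix pencil is a polynomial matrix $G(s)=G_0+sG_1$ with constant matrices $G_0,G_1$ over $\mathbb F$; its (normal) rank is its rank over the field of fractions $\mathbb F(s)$. It is regular if it is square and $\det G(s)$ is not the zero polynomial. Two pencils $G(s),H(s)\in\mathbb F[s]^{n\times n}$ are strictly equivalent if $G(s)=Q\,H(s)\,R$ for some $Q,R\in \mathrm{GL}_n(\mathbb F)$. For a pencil $G(s)=G_0+sG_1$ of rank $\rho$, let $\Delta_0(s,t)=1$ and, for $1\le k\le\rho$, let $\Delta_k(s,t)\in\mathbb F[s,t]$ be the greatest common divisor of the minors of order $k$ of the homogeneous pencil $G(s,t)=tG_0+sG_1$, normalized to be monic with respect to $s$ (the coefficient of the monomial of this homogeneous polynomial with the highest power of $s$ is $1$). The homogeneous invariant factors of $G(s)$ are $$\Gamma_k(s,t)=\frac{\Delta_k(s,t)}{\Delta_{k-1}(s,t)},\qquad 1\le k\le \rho,$$ and one puts $\Gamma_i(s,t)=1$ for integers $i<1$ and $\Gamma_i(s,t)=0$ for integers $i>\rho$. **Proposition.** Let $A(s),B(s)\in\mathbb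 F[s]^{n\times n}$ be regular matrix pencils, and let $P(s)\in\mathbb F[s]^{n\times n}$ be a matrix pencil with $\operatorname{rank} P(s)=r$ such that $A(s)+P(s)$ is strictly equivalent to $B(s)$. Let $\phi_i(s,t)$ and $\psi_i(s,t)$, $i\in\mathbb Z$, be the homogeneous invariant factors of $A(s)$ and $B(s)$, respectively, with the above convention for $i<1$ and $i>n$. Then, in $\mathbb F[s,t]$, $$\phi_{i-r}(s,t)\mid \psi_i(s,t)\mid \phi_{i+r}(s,t),\qquad 1\le i\le n.$$ -/

import Mathlib

open scoped Polynomial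

noncomputable section

namespace MatrixPencil

variable {F : Type*} [Field F] {m n : ℕ}

/-- A matrix pencil: a polynomial matrix of degree at most one. -/
def IsPencil (G : Matrix (Fin m) (Fin n) F[X]) : Prop :=
  ∀ i j, (G i j).natDegree ≤ 1

/-- A regular pencil: a square pencil whose determinant is not the zero polynomial. -/
def IsRegularPencil (G : Matrix (Fin n) (Fin n) F[X]) : Prop :=
  IsPencil G ∧ G.det ≠ 0

/-- The normal rank of a polynomial matrix: its rank over the field of fractions `F(s)`. -/
def normalRank (G : Matrix (Fin m) (Fin n) F[X]) : ℕ :=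
  (G.map (algebraMap F[X] (RatFunc F))).rank

/-- Strict equivalence: `G(s) = Q H(s) R` with constant invertible matrices `Q` and `R`. -/
def StrictlyEquivalent (G H : Matrix (Fin m) (Fin n) F[X]) : Prop :=
  ∃ (Q : GL (Fin m) F) (R : GL (Fin n) F),
    G = (Q : Matrix (Fin m) (Fin m) F).map Polynomial.C * H *
      (R : Matrix (Fin n) (Fin n) F).map Polynomial.C

/-- The homogeneous pencil `G(s,t) = t G₀ + s G₁` of `G(s) = G₀ + s G₁`, where `F[s,t]` is
`MvPolynomial (Fin 2) F` with `s = X 0` and `t = X 1`. -/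
def homogeneousPencil (G : Matrix (Fin m) (Fin n) F[X]) :
    Matrix (Fin m) (Fin n) (MvPolynomial (Fin 2) F) :=
  fun i j => MvPolynomial.X 1 * MvPolynomial.C ((G i j).coeff 0) +
    MvPolynomial.X 0 * MvPolynomial.C ((G i j).coeff 1)

/-- The minor of the homogeneous pencil on the `k` rows `f` and the `k` columns `g`. -/
def homogeneousMinor (G : Matrix (Fin m) (Fin n) F[X]) {k : ℕ}
    (f : Fin k ↪o Fin m) (g : Fin k ↪o Fin n) : MvPolynomial (Fin 2) F :=
  ((homogeneousPencil G).submatrix f g).det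

/-- `D` is the greatest common divisor of the minors of order `k` of `G(s,t)`, and it is monic
with respect to `s` unless it is zero.  In the lexicographic order with `s > t` the leading
monomial is, among those with the highest power of `s`, the one with the highest power of `t`;
a homogeneous polynomial has at most one monomial with the highest power of `s`. -/
structure IsHomogeneousDetDivisor (G : Matrix (Fin m) (Fin n) F[X]) (k : ℕ)
    (D : MvPolynomial (Fin 2) F) : Prop where
  dvd_minor : ∀ (f : Fin k ↪o Fin m) (g : Fin k ↪o Fin n), D ∣ homogeneousMinor G f g
  dvd_of_dvd_minor : ∀ E : MvPolynomial (Fin 2) F,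
    (∀ (f : Fin k ↪o Fin m) (g : Fin k ↪o Fin n), E ∣ homogeneousMinor G f g) → E ∣ D
  monic : D ≠ 0 → (MonomialOrder.lex : MonomialOrder (Fin 2)).Monic D

theorem exists_isGCD {R ι : Type*} [CommRing R] [IsDomain R] [UniqueFactorizationMonoid R]
    [Fintype ι] (p : ι → R) :
    ∃ D : R, (∀ x, D ∣ p x) ∧ ∀ E : R, (∀ x, E ∣ p x) → E ∣ D := by
  classical
  let _ : NormalizedGCDMonoid R := Classical.choice inferInstance
  exact ⟨Finset.univ.gcd p, fun x => Finset.gcd_dvd (Finset.mem_univ x),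
    fun E hE => Finset.dvd_gcd fun x _ => hE x⟩

theorem IsHomogeneousDetDivisor.unique {G : Matrix (Fin m) (Fin n) F[X]} {k : ℕ}
    {D D' : MvPolynomial (Fin 2) F} (h : IsHomogeneousDetDivisor G k D)
    (h' : IsHomogeneousDetDivisor G k D') : D = D' := by
  have h1 : D ∣ D' := h'.dvd_of_dvd_minor D h.dvd_minor
  have h2 : D' ∣ D := h.dvd_of_dvd_minor D' h'.dvd_minor
  by_cases hD : D = 0
  · subst hD
    exact (zero_dvd_iff.mp h1).symm
  · have hD' : D' ≠ 0 := fun h0 => hD (zero_dvd_iff.mp (h0 ▸ h2))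
    obtain ⟨u, hu⟩ := associated_of_dvd_dvd h1 h2
    obtain ⟨c, hc, huc⟩ := MvPolynomial.isUnit_iff_eq_C_of_isReduced.mp u.isUnit
    have hm := h.monic hD
    have hm' := h'.monic hD'
    rw [MonomialOrder.Monic, ← hu, MonomialOrder.leadingCoeff_mul, hm,
      one_mul, huc, MonomialOrder.leadingCoeff_C] at hm'
    rw [← hu, huc, hm', MvPolynomial.C_1, mul_one]

theorem exists_isHomogeneousDetDivisor (G : Matrix (Fin m) (Fin n) F[X]) (k : ℕ) :
    ∃ D : MvPolynomial (Fin 2) F, IsHomogeneousDetDivisor G k D := by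
  classical
  obtain ⟨D₀, h1, h2⟩ : ∃ D : MvPolynomial (Fin 2) F,
      (∀ (f : Fin k ↪o Fin m) (g : Fin k ↪o Fin n), D ∣ homogeneousMinor G f g) ∧
      ∀ E : MvPolynomial (Fin 2) F,
        (∀ (f : Fin k ↪o Fin m) (g : Fin k ↪o Fin n), E ∣ homogeneousMinor G f g) → E ∣ D := by
    obtain ⟨D, h1, h2⟩ := exists_isGCD
      (fun p : (Fin k ↪o Fin m) × (Fin k ↪o Fin n) => homogeneousMinor G p.1 p.2)
    exact ⟨D, fun f g => h1 (f, g), fun E hE => h2 E fun p => hE p.1 p.2⟩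
  have hu : ∀ c : F, c ≠ 0 → IsUnit (MvPolynomial.C c : MvPolynomial (Fin 2) F) :=
    fun c hc => (isUnit_iff_ne_zero.mpr hc).map MvPolynomial.C
  refine ⟨MvPolynomial.C ((MonomialOrder.lex : MonomialOrder (Fin 2)).leadingCoeff D₀)⁻¹ * D₀,
    ?_⟩
  by_cases hD : D₀ = 0
  · subst hD
    exact ⟨by simpa using h1, by simp, fun h => absurd (by simp) h⟩
  · have hl : (MonomialOrder.lex : MonomialOrder (Fin 2)).leadingCoeff D₀ ≠ 0 :=
      MonomialOrder.leadingCoeff_ne_zero_iff.mpr hD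
    have hc := hu _ (inv_ne_zero hl)
    refine ⟨fun f g => (hc.mul_left_dvd).mpr (h1 f g),
      fun E hE => (hc.dvd_mul_left).mpr (h2 E hE), fun _ => ?_⟩
    rw [MonomialOrder.Monic, MonomialOrder.leadingCoeff_mul,
      MonomialOrder.leadingCoeff_C, inv_mul_cancel₀ hl]

/-- The homogeneous determinantal divisor `Δ_k(s,t)`.  In particular `Δ_0 = 1`. -/
def homogeneousDetDivisor (G : Matrix (Fin m) (Fin n) F[X]) (k : ℕ) :
    MvPolynomial (Fin 2) F :=
  (exists_isHomogeneousDetDivisor G k).choose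

theorem homogeneousDetDivisor_spec (G : Matrix (Fin m) (Fin n) F[X]) (k : ℕ) :
    IsHomogeneousDetDivisor G k (homogeneousDetDivisor G k) :=
  (exists_isHomogeneousDetDivisor G k).choose_spec

theorem homogeneousDetDivisor_dvd_succ (G : Matrix (Fin m) (Fin n) F[X]) (k : ℕ) :
    homogeneousDetDivisor G k ∣ homogeneousDetDivisor G (k + 1) := by
  refine (homogeneousDetDivisor_spec G (k + 1)).dvd_of_dvd_minor _ fun f g => ?_
  rw [homogeneousMinor, Matrix.det_succ_row_zero]
  refine Finset.dvd_sum fun j _ => Dvd.dvd.mul_left ?_ _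
  exact (homogeneousDetDivisor_spec G k).dvd_minor
    ((Fin.succOrderEmb k).trans f) ((Fin.succAboveOrderEmb j).trans g)

/-- The homogeneous invariant factors `Γ_i(s,t)`, `i ∈ ℤ`: the quotient `Δ_i / Δ_{i-1}` for
`1 ≤ i ≤ rank G(s)` (where `Δ_{i-1} ≠ 0`), with `Γ_i = 1` for `i < 1` and `Γ_i = 0` for
`i > rank G(s)`. -/
def homogeneousInvariantFactor (G : Matrix (Fin m) (Fin n) F[X]) (i : ℤ) :
    MvPolynomial (Fin 2) F :=
  if i < 1 then 1
  else if (normalRank G : ℤ) < i then 0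
  else (homogeneousDetDivisor_dvd_succ G (i - 1).toNat).choose

theorem homogeneousDetDivisor_mul_invariantFactor (G : Matrix (Fin m) (Fin n) F[X]) (k : ℕ)
    (hk : k + 1 ≤ normalRank G) :
    homogeneousDetDivisor G k * homogeneousInvariantFactor G (k + 1) =
      homogeneousDetDivisor G (k + 1) := by
  have hi : ((k : ℤ) + 1 - 1).toNat = k := by omega
  have h := (homogeneousDetDivisor_dvd_succ G ((k : ℤ) + 1 - 1).toNat).choose_spec
  rw [homogeneousInvariantFactor, if_neg (by omega), if_neg (by omega)]
  generalize_proofs pf at h ⊢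
  generalize pf.choose = c at h ⊢
  rw [hi] at h
  exact h.symm

end MatrixPencil

end

open scoped Polynomial

noncomputable section

/-! ### Ranks, bordered minors and the divisibility between minors -/

namespace Matrix

/-! Everything rests on one divisibility over a GCD domain, `Matrix.dvd_mul_minor_mul_minor`. Let `Y
= Q X S + N` with `rank N ≤ r`. For a nonzero `k`-minor `x` of `X`, subtracting from `x X` a matrix
of rank at most `k` leaves bordered minors of order `k + 1`. Hence `x Y` is a matrix divisible by
`Δ_{k+1}(X)` plus one of rank at most `k + r`. On any `k + r + 1` rows and columns the second
summand kills a primitive vector, and multiplying by the adjugate of that block of `Y` gains a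
factor `Δ_{k+r}(Y)`.

Passing to gcds gives `Δ_{k+1}(X) Δ_{k+r}(Y) ∣ Δ_k(X) Δ_{k+r+1}(Y)`, and cancelling `Δ_k(X)
Δ_{k+r}(Y)` compares the invariant factors directly in `F[s,t]`, with no Smith form and no
localization. Both halves of the theorem are this statement, since the relation between `A` and `B`
is symmetric up to a perturbation of rank at most `r`. -/

theorem rank_add_le_add {K m n : Type*} [Field K] [Fintype m] [Fintype n]
    (A B : Matrix m n K) : (A + B).rank ≤ A.rank + B.rank := by
  rw [Matrix.rank, Matrix.rank, Matrix.rank, Matrix.mulVecLin_add]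
  refine le_trans (Submodule.finrank_mono ?_) (Submodule.finrank_add_le_finrank_add_finrank _ _)
  rintro _ ⟨v, rfl⟩
  exact Submodule.add_mem_sup ⟨v, rfl⟩ ⟨v, rfl⟩

theorem rank_map_le_of_field {K L n : Type*} [Field K] [Field L] [Fintype n] [DecidableEq n]
    (σ : K →+* L) (A : Matrix n n K) : (A.map σ).rank ≤ A.rank := by
  obtain ⟨V, U, e, hV, hU, h⟩ := exists_rank_normal_form A
  have hdet : ∀ W : Matrix n n K, IsUnit W → IsUnit (W.map σ).det := fun W hW => by
    rw [← RingHom.mapMatrix_apply, ← RingHom.map_det]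
    exact ((isUnit_iff_isUnit_det W).mp hW).map σ
  rw [← rank_mul_eq_right_of_isUnit_det (V.map σ) (A.map σ) (hdet V hV),
    ← rank_mul_eq_left_of_isUnit_det (U.map σ) _ (hdet U hU), ← Matrix.map_mul, ← Matrix.map_mul, h,
    ← submatrix_map, fromBlocks_map, rank_submatrix]
  have hJ : fromBlocks ((1 : Matrix (Fin A.rank) (Fin A.rank) K).map σ)
      ((0 : Matrix (Fin A.rank) (Fin (Fintype.card n - A.rank)) K).map σ)
      ((0 : Matrix (Fin (Fintype.card n - A.rank)) (Fin A.rank) K).map σ)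
      ((0 : Matrix (Fin (Fintype.card n - A.rank)) (Fin (Fintype.card n - A.rank)) K).map σ) =
      -- The normal form factors through a space of dimension `A.rank`, which bounds its rank over
      -- `L`.
      fromRows (1 : Matrix (Fin A.rank) (Fin A.rank) L)
        (0 : Matrix (Fin (Fintype.card n - A.rank)) (Fin A.rank) L) *
      fromCols (1 : Matrix (Fin A.rank) (Fin A.rank) L)
        (0 : Matrix (Fin A.rank) (Fin (Fintype.card n - A.rank)) L) := by
    rw [fromRows_mul_fromCols]
    simp
  rw [hJ]
  refine (rank_mul_le_left _ _).trans ?_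
  simpa using rank_le_card_width
    (fromRows (1 : Matrix (Fin A.rank) (Fin A.rank) L)
      (0 : Matrix (Fin (Fintype.card n - A.rank)) (Fin A.rank) L))

/-- Schur complement in the fraction field, where the adjugate is the determinant times the inverse.
-/
theorem det_submatrix_eq_mul_sub {R m n ι : Type*} [CommRing R] [IsDomain R] [Fintype ι] [DecidableEq ι]
    (X : Matrix m n R) (f : ι → m) (g : ι → n) (a : m) (b : n) (h : (X.submatrix f g).det ≠ 0) :
    (X.submatrix (Sum.elim f fun _ : Unit => a) (Sum.elim g fun _ : Unit => b)).det =
      (X.submatrix f g).det * X a b -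
        (X.submatrix id g * (X.submatrix f g).adjugate * X.submatrix f id) a b := by
  let K := FractionRing R
  let φ := algebraMap R K
  have hφ : Function.Injective φ := IsFractionRing.injective R K
  have hb : X.submatrix (Sum.elim f fun _ : Unit => a) (Sum.elim g fun _ : Unit => b) =
      fromBlocks (X.submatrix f g) (X.submatrix f fun _ => b) (X.submatrix (fun _ => a) g)
        (X.submatrix (fun _ => a) fun _ => b) := by
    ext (i | i) (j | j) <;> rfl
  apply hφ
  have hd : ((X.submatrix f g).map φ).det = φ (X.submatrix f g).det := (RingHom.map_det φ _).symm
  have hd0 : φ (X.submatrix f g).det ≠ 0 := (map_ne_zero_iff φ hφ).mpr h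
  have hu : IsUnit ((X.submatrix f g).map φ).det := by rw [hd]; exact isUnit_iff_ne_zero.mpr hd0
  let _ := invertibleOfIsUnitDet _ hu
  rw [hb, RingHom.map_det, RingHom.mapMatrix_apply, fromBlocks_map, det_fromBlocks₁₁, hd,
    det_unique (n := Unit), invOf_eq_nonsing_inv, inv_def, hd, Ring.inverse_eq_inv']
  have ha : ((X.submatrix f g).map φ).adjugate = (X.submatrix f g).adjugate.map φ :=
    (RingHom.map_adjugate φ _).symm
  rw [ha, map_sub, map_mul, sub_apply, mul_sub]
  congr 1
  have e : φ ((X.submatrix id g * (X.submatrix f g).adjugate * X.submatrix f id) a b) =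
      ((X.submatrix id g * (X.submatrix f g).adjugate * X.submatrix f id).map φ) a b := rfl
  rw [e, Matrix.map_mul, Matrix.map_mul, Matrix.mul_smul, Matrix.smul_mul, smul_apply, smul_eq_mul, ← mul_assoc,
    mul_inv_cancel₀ hd0, one_mul]
  rfl

theorem exists_equiv_orderEmb_comp {ι : Type*} [Fintype ι] {m k : ℕ} (hk : Fintype.card ι = k)
    (f : ι → Fin m) (hf : Function.Injective f) :
    ∃ (e : ι ≃ Fin k) (F : Fin k ↪o Fin m), f = F ∘ e := by
  classical
  have hc : (Finset.univ.image f).card = k := by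
    rw [Finset.card_image_of_injective _ hf, Finset.card_univ, hk]
  let F := (Finset.univ.image f).orderEmbOfFin hc
  have hF : ∀ i, ∃ j, F j = f i := fun i => by
    have : f i ∈ Set.range F := by
      rw [Finset.range_orderEmbOfFin]; simp
    exact this
  choose e he using hF
  have hinj : Function.Injective e := fun i j hij => hf (by rw [← he, ← he, hij])
  have hbij : Function.Bijective e :=
    (Fintype.bijective_iff_injective_and_card e).mpr ⟨hinj, by simpa using hk⟩
  exact ⟨Equiv.ofBijective e hbij, F, funext fun i => (he i).symm⟩

/-- A repeated row or column gives determinant zero; otherwise sorting the indices changes only the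
sign. This frees bordered minors and cofactors from the increasing order of indices. -/
theorem dvd_det_submatrix_of_dvd_minors {R ι : Type*} [CommRing R] [Fintype ι] [DecidableEq ι]
    {m n k : ℕ} (hk : Fintype.card ι = k) {X : Matrix (Fin m) (Fin n) R} {D : R}
    (hD : ∀ (f : Fin k ↪o Fin m) (g : Fin k ↪o Fin n), D ∣ (X.submatrix f g).det)
    (f : ι → Fin m) (g : ι → Fin n) : D ∣ (X.submatrix f g).det := by
  by_cases hf : Function.Injective f
  · by_cases hg : Function.Injective g
    · obtain ⟨e, F, rfl⟩ := exists_equiv_orderEmb_comp hk f hf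
      obtain ⟨e', G, rfl⟩ := exists_equiv_orderEmb_comp hk g hg
      have h : X.submatrix (F ∘ e) (G ∘ e') =
          ((X.submatrix F G).submatrix e e).submatrix id (e'.trans e.symm) := by
        ext i j; simp
      rw [h, det_permute', det_submatrix_equiv_self]
      exact (hD F G).mul_left _
    · rw [Function.not_injective_iff] at hg
      obtain ⟨i, j, hij, hne⟩ := hg
      rw [det_zero_of_column_eq hne fun l => by simp [hij]]
      exact dvd_zero _
  · rw [Function.not_injective_iff] at hf
    obtain ⟨i, j, hij, hne⟩ := hf
    rw [det_zero_of_row_eq hne (by ext l; simp [hij])]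
    exact dvd_zero _

theorem dvd_mul_apply {R l m n : Type*} [CommRing R] [Fintype m] {D : R} (A : Matrix l m R)
    {B : Matrix m n R} (h : ∀ i j, D ∣ B i j) (i : l) (j : n) : D ∣ (A * B) i j :=
  Finset.dvd_sum fun _ _ => (h _ _).mul_left _

theorem dvd_mul_apply' {R l m n : Type*} [CommRing R] [Fintype m] {D : R} {A : Matrix l m R}
    (B : Matrix m n R) (h : ∀ i j, D ∣ A i j) (i : l) (j : n) : D ∣ (A * B) i j :=
  Finset.dvd_sum fun _ _ => (h _ _).mul_right _

theorem dvd_of_dvd_mul_of_gcd_eq_one {R ι : Type*} [CommRing R] [IsDomain R] [NormalizedGCDMonoid R]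
    {s : Finset ι} {w : ι → R} (hw : s.gcd w = 1) {d c : R} (h : ∀ i ∈ s, d ∣ c * w i) : d ∣ c := by
  have := Finset.dvd_gcd h
  rwa [(Finset.gcd_mul_left' ..).dvd_iff_dvd_right, hw, mul_one] at this

theorem dvd_mul_minor_mul_minor {R : Type*} [CommRing R] [IsDomain R] [NormalizedGCDMonoid R]
    {n k r : ℕ} {X Y Q S N : Matrix (Fin n) (Fin n) R} (hY : Y = Q * X * S + N)
    (hN : (N.map (algebraMap R (FractionRing R))).rank ≤ r) {D E : R}
    (hD : ∀ (f g : Fin (k + 1) ↪o Fin n), D ∣ (X.submatrix f g).det)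
    (hE : ∀ (f g : Fin (k + r) ↪o Fin n), E ∣ (Y.submatrix f g).det)
    (f g : Fin k ↪o Fin n) (f' g' : Fin (k + r + 1) ↪o Fin n) :
    D * E ∣ (X.submatrix f g).det * (Y.submatrix f' g').det := by
  set x := (X.submatrix f g).det with hx
  by_cases hx0 : x = 0
  · simp [hx0]
  set L := X.submatrix id g * (X.submatrix f g).adjugate * X.submatrix f id with hL
  have hXL : ∀ i j, D ∣ (x • X - L) i j := fun i j => by
    rw [sub_apply, smul_apply, smul_eq_mul, hx, hL, ← det_submatrix_eq_mul_sub X f g i j hx0]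
    exact dvd_det_submatrix_of_dvd_minors (by simp) hD _ _
  -- `L` factors through `k` columns, so `T` has rank at most `k + r`.
  set T := Q * L * S + x • N with hT
  have hxY : x • Y = Q * (x • X - L) * S + T := by
    simp only [hY, hT, Matrix.mul_sub, Matrix.sub_mul, smul_add, Matrix.mul_smul, Matrix.smul_mul]
    abel
  have hdet : (T.submatrix f' g').det = 0 := by
    let φ := algebraMap R (FractionRing R)
    have hφ : Function.Injective φ := IsFractionRing.injective R _
    by_contra h0
    have h1 : ((T.submatrix f' g').map φ).det ≠ 0 := by
      rw [← RingHom.mapMatrix_apply, ← RingHom.map_det]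
      exact (map_ne_zero_iff φ hφ).mpr h0
    have h2 := rank_of_det_ne_zero h1
    have h3 : ((T.submatrix f' g').map φ).rank ≤ (T.map φ).rank :=
      rank_submatrix_le (T.map φ) f' g'
    have h4 : T.map φ = Q.map φ * (X.submatrix id g).map φ * ((X.submatrix f g).adjugate.map φ *
        (X.submatrix f id).map φ * S.map φ) + φ x • N.map φ := by
      rw [hT, Matrix.map_add φ (map_add φ), Matrix.map_mul, Matrix.map_mul, hL, Matrix.map_mul, Matrix.map_mul]
      congr 1
      · simp only [Matrix.mul_assoc]
      · ext i j; simp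
    have h5 : (T.map φ).rank ≤ k + r := by
      rw [h4]
      refine (rank_add_le_add _ _).trans (add_le_add ?_ ?_)
      · refine (rank_mul_le_left _ _).trans ?_
        simpa using rank_le_card_width (Q.map φ * (X.submatrix id g).map φ)
      · have : φ x • N.map φ = (φ x • (1 : Matrix (Fin n) (Fin n) _)) * N.map φ := by simp
        rw [this]
        exact (rank_mul_le_right _ _).trans hN
    simp only [Fintype.card_fin] at h2
    omega
  obtain ⟨w₀, hw0, hTw0⟩ := exists_mulVec_eq_zero_iff.mpr hdet
  -- Dividing the kernel vector by its content makes it primitive, so a divisor of every `c * w i`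
  -- divides `c`.
  obtain ⟨w, hw, hgcd⟩ := Finset.extract_gcd w₀ (s := Finset.univ) Finset.univ_nonempty
  have hw' : w₀ = Finset.univ.gcd w₀ • w := funext fun i => hw i (Finset.mem_univ i)
  have hg0 : Finset.univ.gcd w₀ ≠ 0 := fun h => hw0 (by rw [hw', h, zero_smul])
  have hTw : T.submatrix f' g' *ᵥ w = 0 := by
    rw [hw', mulVec_smul] at hTw0
    exact (smul_eq_zero.mp hTw0).resolve_left hg0
  refine dvd_of_dvd_mul_of_gcd_eq_one hgcd fun i _ => ?_
  set Z := (Q * (x • X - L) * S).submatrix f' g' with hZ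
  have hsub : x • Y.submatrix f' g' = Z + T.submatrix f' g' := by
    exact congrArg (fun W => W.submatrix f' g') hxY
  have key : (x * (Y.submatrix f' g').det) • w = (Y.submatrix f' g').adjugate *ᵥ (Z *ᵥ w) := by
    have : Z *ᵥ w = (x • Y.submatrix f' g') *ᵥ w := by
      rw [hsub, add_mulVec, hTw, add_zero]
    rw [this, mulVec_mulVec, Matrix.mul_smul, adjugate_mul, smul_smul, smul_mulVec, one_mulVec]
  have hi := congrFun key i
  rw [Pi.smul_apply, smul_eq_mul] at hi
  rw [hi]
  have hZD : ∀ i j, D ∣ Z i j := fun i j =>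
    dvd_mul_apply' S (dvd_mul_apply Q hXL) _ _
  rw [mulVec, dotProduct]
  refine Finset.dvd_sum fun l _ => ?_
  rw [mul_comm D E]
  refine mul_dvd_mul ?_ ?_
  -- Adjugate entries are, up to sign, minors of `Y` of order `k + r`.
  · rw [adjugate_fin_succ_eq_det_submatrix, submatrix_submatrix]
    exact (dvd_det_submatrix_of_dvd_minors (by simp) hE _ _).mul_left _
  · rw [mulVec, dotProduct]
    exact Finset.dvd_sum fun c _ => (hZD l c).mul_right _

end Matrix

/-! ### Homogenization of pencils and the rank of the homogeneous pencil -/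

namespace MatrixPencil

variable {F : Type*} [Field F] {m n : ℕ}

theorem homogeneousPencil_add (G H : Matrix (Fin m) (Fin n) F[X]) :
    homogeneousPencil (G + H) = homogeneousPencil G + homogeneousPencil H := by
  ext1 i j
  simp only [homogeneousPencil, Matrix.add_apply, Polynomial.coeff_add, map_add]
  ring

theorem homogeneousPencil_const_mul_mul (Q : Matrix (Fin m) (Fin m) F)
    (G : Matrix (Fin m) (Fin n) F[X]) (R : Matrix (Fin n) (Fin n) F) :
    homogeneousPencil (Q.map Polynomial.C * G * R.map Polynomial.C) =
      (Q.map MvPolynomial.C : Matrix (Fin m) (Fin m) (MvPolynomial (Fin 2) F)) *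
        homogeneousPencil G *
        (R.map MvPolynomial.C : Matrix (Fin n) (Fin n) (MvPolynomial (Fin 2) F)) := by
  ext1 i j
  simp only [homogeneousPencil, Matrix.mul_apply, Matrix.map_apply, Polynomial.finsetSum_coeff,
    Polynomial.coeff_mul_C, Polynomial.coeff_C_mul, map_sum, map_mul, Finset.mul_sum,
    Finset.sum_mul, ← Finset.sum_add_distrib]
  refine Finset.sum_congr rfl fun _ _ => Finset.sum_congr rfl fun _ _ => ?_
  ring

/-- Setting `s = X`, `t = 1` in a bivariate polynomial. -/
def dehomogenize : MvPolynomial (Fin 2) F →+* F[X] :=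
  (MvPolynomial.aeval ![Polynomial.X, 1] : MvPolynomial (Fin 2) F →ₐ[F] F[X]).toRingHom

theorem map_dehomogenize_homogeneousPencil {G : Matrix (Fin m) (Fin n) F[X]} (hG : IsPencil G) :
    (homogeneousPencil G).map dehomogenize = G := by
  ext1 i j
  conv_rhs => rw [Polynomial.eq_X_add_C_of_natDegree_le_one (hG i j)]
  simp [homogeneousPencil, dehomogenize, Polynomial.algebraMap_eq]
  ring

theorem IsRegularPencil.det_homogeneousPencil_ne_zero {G : Matrix (Fin n) (Fin n) F[X]}
    (hG : IsRegularPencil G) : (homogeneousPencil G).det ≠ 0 := fun h => hG.2 <| by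
  rw [← map_dehomogenize_homogeneousPencil hG.1, ← RingHom.mapMatrix_apply, ← RingHom.map_det, h,
    map_zero]

theorem IsRegularPencil.normalRank_eq {G : Matrix (Fin n) (Fin n) F[X]}
    (hG : IsRegularPencil G) : normalRank G = n := by
  rw [normalRank, Matrix.rank_of_det_ne_zero, Fintype.card_fin]
  rw [← RingHom.mapMatrix_apply, ← RingHom.map_det]
  exact (map_ne_zero_iff _ (IsFractionRing.injective F[X] (RatFunc F))).mpr hG.2

theorem IsRegularPencil.homogeneousDetDivisor_ne_zero {G : Matrix (Fin n) (Fin n) F[X]}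
    (hG : IsRegularPencil G) {k : ℕ} (hk : k ≤ n) : homogeneousDetDivisor G k ≠ 0 := by
  have h : ∀ l, k ≤ l → homogeneousDetDivisor G k ∣ homogeneousDetDivisor G l := fun l hl => by
    induction l, hl using Nat.le_induction with
    | base => exact dvd_rfl
    | succ l _ ih => exact ih.trans (homogeneousDetDivisor_dvd_succ G l)
  intro h0
  have h1 := (h n hk).trans ((homogeneousDetDivisor_spec G n).dvd_minor
    (RelEmbedding.refl _) (RelEmbedding.refl _))
  rw [h0, zero_dvd_iff] at h1
  exact hG.det_homogeneousPencil_ne_zero h1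

/-- The ring homomorphism `F[s] → F(s,t)` given by `s ↦ s / t`. -/
def homogenizeHom (F : Type*) [Field F] :
    F[X] →+* FractionRing (MvPolynomial (Fin 2) F) :=
  Polynomial.eval₂RingHom
    ((algebraMap (MvPolynomial (Fin 2) F) (FractionRing (MvPolynomial (Fin 2) F))).comp
      MvPolynomial.C)
    (algebraMap (MvPolynomial (Fin 2) F) (FractionRing (MvPolynomial (Fin 2) F))
        (MvPolynomial.X 0) /
      algebraMap (MvPolynomial (Fin 2) F) (FractionRing (MvPolynomial (Fin 2) F))
        (MvPolynomial.X 1))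

/-- If `p(s/t) = 0`, clearing denominators with `scaleRoots` gives a relation in `F[s,t]`, and `t =
1` turns it into `p = 0`. -/
theorem homogenizeHom_injective : Function.Injective (homogenizeHom F) := by
  rw [injective_iff_map_eq_zero]
  intro p hp
  by_contra hp0
  let K := FractionRing (MvPolynomial (Fin 2) F)
  have hφ : Function.Injective (algebraMap (MvPolynomial (Fin 2) F) K) :=
    IsFractionRing.injective _ _
  rw [homogenizeHom, Polynomial.coe_eval₂RingHom, ← Polynomial.eval₂_map] at hp
  have h := Polynomial.scaleRoots_eval₂_eq_zero_of_eval₂_div_eq_zero hφ hp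
    (mem_nonZeroDivisors_of_ne_zero (MvPolynomial.X_ne_zero 1))
  rw [Polynomial.eval₂_at_apply, map_eq_zero_iff _ hφ] at h
  have h2 := congrArg dehomogenize h
  rw [map_zero, ← Polynomial.eval₂_at_apply, ← Polynomial.eval_map, Polynomial.map_scaleRoots,
    Polynomial.map_map] at h2
  · have h3 : (dehomogenize.comp MvPolynomial.C : F →+* F[X]) = Polynomial.C := by
      ext a : 1; simp [dehomogenize, Polynomial.algebraMap_eq]
    have hs : dehomogenize (MvPolynomial.X 0 : MvPolynomial (Fin 2) F) = Polynomial.X := by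
      simp [dehomogenize]
    have ht : dehomogenize (MvPolynomial.X 1 : MvPolynomial (Fin 2) F) = 1 := by
      simp [dehomogenize]
    rw [h3, hs, ht, Polynomial.scaleRoots_one, Polynomial.eval_map, Polynomial.eval₂_C_X] at h2
    exact hp0 h2
  · rw [Polynomial.leadingCoeff_map_of_injective (MvPolynomial.C_injective _ F)]
    simpa [dehomogenize, Polynomial.algebraMap_eq] using hp0

/-- `P(s,t) = t P(s/t)`, and `s ↦ s/t` extends to a field map on `F(s)`, which does not raise the
rank. -/
theorem rank_homogeneousPencil_le {P : Matrix (Fin n) (Fin n) F[X]} (hP : IsPencil P) :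
    ((homogeneousPencil P).map (algebraMap (MvPolynomial (Fin 2) F)
      (FractionRing (MvPolynomial (Fin 2) F)))).rank ≤ normalRank P := by
  let K := FractionRing (MvPolynomial (Fin 2) F)
  let φ := algebraMap (MvPolynomial (Fin 2) F) K
  have ht : φ (MvPolynomial.X 1) ≠ 0 :=
    (map_ne_zero_iff φ (IsFractionRing.injective _ _)).mpr (MvPolynomial.X_ne_zero 1)
  let σ : RatFunc F →+* K := IsFractionRing.lift (homogenizeHom_injective (F := F))
  have h : (homogeneousPencil P).map φ = (φ (MvPolynomial.X 1) • (1 : Matrix (Fin n) (Fin n) K)) *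
      ((P.map (algebraMap F[X] (RatFunc F))).map σ) := by
    rw [Matrix.smul_mul, one_mul]
    ext1 i j
    have hσ : σ (algebraMap F[X] (RatFunc F) (P i j)) = homogenizeHom F (P i j) :=
      IsFractionRing.lift_algebraMap _ _
    rw [Matrix.smul_apply, Matrix.map_apply, Matrix.map_apply, Matrix.map_apply, hσ]
    conv_rhs => rw [Polynomial.eq_X_add_C_of_natDegree_le_one (hP i j)]
    simp only [homogeneousPencil, homogenizeHom, map_add, map_mul, Polynomial.coe_eval₂RingHom,
      Polynomial.eval₂_C, Polynomial.eval₂_X, RingHom.comp_apply, smul_eq_mul]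
    change φ _ * φ _ + φ _ * φ _ = φ _ * (φ _ * (φ _ / φ _) + φ _)
    rw [mul_add, mul_div_assoc', mul_comm (φ _) (φ _ * _ / _)]
    have := div_mul_cancel₀ (φ (MvPolynomial.C ((P i j).coeff 1)) * φ (MvPolynomial.X 0)) ht
    rw [this]
    ring
  change ((homogeneousPencil P).map φ).rank ≤ _
  rw [h]
  exact (Matrix.rank_mul_le_right _ _).trans (Matrix.rank_map_le_of_field σ _)

/-! ### From minors to invariant factors -/

theorem dvd_mul_of_forall_dvd_mul {R ι : Type*} [CommRing R] [IsDomain R]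
    [NormalizedGCDMonoid R] [Fintype ι] {p : ι → R} {D d c : R}
    (hD : ∀ E, (∀ x, E ∣ p x) → E ∣ D) (h : ∀ x, d ∣ p x * c) : d ∣ D * c := by
  have h1 := Finset.dvd_gcd (s := Finset.univ) (f := fun x => p x * c) fun x _ => h x
  rw [(Finset.gcd_mul_right' ..).dvd_iff_dvd_right] at h1
  exact h1.trans (mul_dvd_mul_right (hD _ fun x => Finset.gcd_dvd (Finset.mem_univ x)) c)

theorem IsHomogeneousDetDivisor.dvd_mul [NormalizedGCDMonoid (MvPolynomial (Fin 2) F)]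
    {G : Matrix (Fin m) (Fin n) F[X]} {k : ℕ}
    {D d c : MvPolynomial (Fin 2) F} (hD : IsHomogeneousDetDivisor G k D)
    (h : ∀ (f : Fin k ↪o Fin m) (g : Fin k ↪o Fin n), d ∣ homogeneousMinor G f g * c) :
    d ∣ D * c :=
  dvd_mul_of_forall_dvd_mul
    (p := fun q : (Fin k ↪o Fin m) × (Fin k ↪o Fin n) => homogeneousMinor G q.1 q.2)
    (fun E hE => hD.dvd_of_dvd_minor E fun f g => hE (f, g)) fun q => h q.1 q.2

theorem invariantFactor_dvd_of_eq_mul_mul_add {G H : Matrix (Fin n) (Fin n) F[X]}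
    (hG : IsRegularPencil G) (hH : IsRegularPencil H)
    {Q S N : Matrix (Fin n) (Fin n) (MvPolynomial (Fin 2) F)} {k r : ℕ} (hk : k + r + 1 ≤ n)
    (hN : (N.map (algebraMap (MvPolynomial (Fin 2) F)
      (FractionRing (MvPolynomial (Fin 2) F)))).rank ≤ r)
    (hGH : homogeneousPencil H = Q * homogeneousPencil G * S + N) :
    homogeneousInvariantFactor G (k + 1) ∣ homogeneousInvariantFactor H ((k + r : ℕ) + 1) := by
  let _ : NormalizedGCDMonoid (MvPolynomial (Fin 2) F) := Classical.choice inferInstance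
  have h : homogeneousDetDivisor G (k + 1) * homogeneousDetDivisor H (k + r) ∣
      homogeneousDetDivisor G k * homogeneousDetDivisor H (k + r + 1) := by
    refine (homogeneousDetDivisor_spec G k).dvd_mul fun f g => ?_
    rw [mul_comm (homogeneousMinor G f g)]
    refine (homogeneousDetDivisor_spec H (k + r + 1)).dvd_mul fun f' g' => ?_
    rw [mul_comm (homogeneousMinor H f' g')]
    exact Matrix.dvd_mul_minor_mul_minor hGH hN (homogeneousDetDivisor_spec G _).dvd_minor
      (homogeneousDetDivisor_spec H _).dvd_minor f g f' g'
  rw [← homogeneousDetDivisor_mul_invariantFactor G k (by rw [hG.normalRank_eq]; omega),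
    ← homogeneousDetDivisor_mul_invariantFactor H (k + r) (by rw [hH.normalRank_eq]; omega)] at h
  -- Regularity makes the common factor nonzero, so it cancels.
  have h0 : homogeneousDetDivisor G k * homogeneousDetDivisor H (k + r) ≠ 0 :=
    mul_ne_zero (hG.homogeneousDetDivisor_ne_zero (by omega))
      (hH.homogeneousDetDivisor_ne_zero (by omega))
  refine (mul_dvd_mul_iff_left h0).mp ?_
  convert h using 1 <;> ring

end MatrixPencil

end

theorem proposition4p2 {F : Type*} [Field F] (n r : ℕ)
    (A B P : Matrix (Fin n) (Fin n) (Polynomial F))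
    (hA : MatrixPencil.IsRegularPencil A) (hB : MatrixPencil.IsRegularPencil B)
    (hP : MatrixPencil.IsPencil P) (hr : MatrixPencil.normalRank P = r)
    (hAB : MatrixPencil.StrictlyEquivalent (A + P) B) (i : ℤ) (hi₁ : 1 ≤ i) (hi₂ : i ≤ n) :
    MatrixPencil.homogeneousInvariantFactor A (i - r) ∣
        MatrixPencil.homogeneousInvariantFactor B i ∧
      MatrixPencil.homogeneousInvariantFactor B i ∣
        MatrixPencil.homogeneousInvariantFactor A (i + r) := by
  obtain ⟨Q, R, hQR⟩ := hAB
  have hom := congrArg MatrixPencil.homogeneousPencil hQR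
  rw [MatrixPencil.homogeneousPencil_add, MatrixPencil.homogeneousPencil_const_mul_mul] at hom
  have hrank := (MatrixPencil.rank_homogeneousPencil_le hP).trans_eq hr
  let φ := algebraMap (MvPolynomial (Fin 2) F) (FractionRing (MvPolynomial (Fin 2) F))
  let q (U : GL (Fin n) F) : Matrix (Fin n) (Fin n) (MvPolynomial (Fin 2) F) :=
    (U : Matrix (Fin n) (Fin n) F).map MvPolynomial.C
  have hq : ∀ U V : GL (Fin n) F, U * V = 1 → q U * q V = 1 := fun U V h => by
    have : (U : Matrix (Fin n) (Fin n) F) * V = 1 := by rw [← Units.val_mul, h, Units.val_one]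
    simp only [q]
    rw [← Matrix.map_mul, this, Matrix.map_one _ (map_zero _) (map_one _)]
  constructor
  -- Outside the range `1, …, n` the conventions `1` and `0` settle both halves.
  · by_cases hir : i - r < 1
    · rw [MatrixPencil.homogeneousInvariantFactor, if_pos hir]
      exact one_dvd _
    · obtain ⟨k, hk⟩ : ∃ k : ℕ, i = (k + r : ℕ) + 1 := ⟨(i - r - 1).toNat, by omega⟩
      have hBA : MatrixPencil.homogeneousPencil B =
          q Q⁻¹ * MatrixPencil.homogeneousPencil A * q R⁻¹ +
            q Q⁻¹ * MatrixPencil.homogeneousPencil P * q R⁻¹ := by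
        rw [← Matrix.add_mul, ← Matrix.mul_add, hom, ← Matrix.mul_assoc, ← Matrix.mul_assoc]
        change _ = q Q⁻¹ * q Q * _ * q R * q R⁻¹
        rw [hq _ _ (inv_mul_cancel Q), one_mul, Matrix.mul_assoc, hq _ _ (mul_inv_cancel R), mul_one]
      have := MatrixPencil.invariantFactor_dvd_of_eq_mul_mul_add hA hB (k := k) (r := r) (by omega)
        (by
          rw [Matrix.map_mul, Matrix.map_mul]
          exact (Matrix.rank_mul_le_left _ _).trans ((Matrix.rank_mul_le_right _ _).trans hrank))
        hBA
      rw [hk, show (((k + r : ℕ) : ℤ) + 1 - r) = k + 1 by push_cast; ring]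
      exact this
  · by_cases hir : (n : ℤ) < i + r
    · rw [MatrixPencil.homogeneousInvariantFactor.eq_1 A, if_neg (by omega), hA.normalRank_eq,
        if_pos hir]
      exact dvd_zero _
    · obtain ⟨k, hk⟩ : ∃ k : ℕ, i = (k : ℤ) + 1 := ⟨(i - 1).toNat, by omega⟩
      -- Same argument with `A` and `B` exchanged and perturbation `-P`.
      have hAB' : MatrixPencil.homogeneousPencil A =
          q Q * MatrixPencil.homogeneousPencil B * q R + -MatrixPencil.homogeneousPencil P := by
        rw [← sub_eq_add_neg]
        exact eq_sub_of_add_eq hom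
      have := MatrixPencil.invariantFactor_dvd_of_eq_mul_mul_add hB hA (k := k) (r := r) (by omega)
        (by
          have h : (-MatrixPencil.homogeneousPencil P).map φ =
              (-1 : Matrix (Fin n) (Fin n) (FractionRing (MvPolynomial (Fin 2) F))) *
                (MatrixPencil.homogeneousPencil P).map φ := by
            ext a b; simp
          exact h.symm ▸ (Matrix.rank_mul_le_right _ _).trans hrank)
        hAB'
      rw [hk, show ((k : ℤ) + 1 + r) = (k + r : ℕ) + 1 by push_cast; ring]
      exact this
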